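/- Let $C \subset \mathbb{R}^n$ be a polytope (the convex hull of finitely many points) containing the origin in its interior. Let $C^\circ = \{y \in \mathbb{R}^n : \langle x,y\rangle \le 1 \text{ for all } x \in C\}$ be its polar, let $\mathrm{ext}(\cdot)$ denote the set of extreme points, and let the nonnegative rank $\mathrm{rank}_+(C)$ be the smallest $k \in \mathbb{N}$ for which there are maps $A : \mathrm{ext}(C) \to \mathbb{R}^k_+$ and $B : \mathrm{ext}(C^\circ) \to (\mathbb{R}^k_+)^* = \mathbb{R}^k_+$ such that $1 - \langle x,y\rangle = \langle A(x), B(y)\rangle$ for all $(x,y) \in \mathrm{ext}(C) \times \mathrm{ext}(C^\circ)$ (and $+\infty$ if there is no such $k$). The faces of $C$ are $\emptyset$ and the sets of maximizers over $C$ of linear functionals (so $C$ itself is a face). There are finitely many faces, and the following hold. 1. Let $p$ be the size of a largest antichain of faces of $C$ (i.e., a largest set of faces such that no one is contained in another). Then $\mathrm{rank}_+(C)$ is at least the smallest integer $k \ge 0$ such that $p \le \binom{k}{\lfloor k/2 \rfloor}$. 2. (Goemans) Let $n_C$ be the number of faces of $C$. Then $\mathrm{rank}_+(C) \ge \log_2(n_C)$.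 -/

import Mathlib

open Set
open scoped InnerProductSpace

noncomputable section

namespace ConeLift

/-- A polytope: the convex hull of finitely many points. -/
def IsPolytope {n : ℕ} (C : Set (EuclideanSpace ℝ (Fin n))) : Prop :=
  ∃ s : Set (EuclideanSpace ℝ (Fin n)), s.Finite ∧ C = convexHull ℝ s

/-- The faces of a polytope `C`: the empty set and all sets of maximizers over `C` of linear
functionals. Both `∅` and `C` itself (zero functional) are faces. -/
def faces {n : ℕ} (C : Set (EuclideanSpace ℝ (Fin n))) : Set (Set (EuclideanSpace ℝ (Fin n))) :=
  {F | IsExposed ℝ C F}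

/-- The polar `C° = {y | ⟪x, y⟫ ≤ 1 for all x ∈ C}`. -/
def polar {n : ℕ} (C : Set (EuclideanSpace ℝ (Fin n))) : Set (EuclideanSpace ℝ (Fin n)) :=
  {y | ∀ x ∈ C, ⟪x, y⟫_ℝ ≤ 1}

/-- The slack operator `S_C(x, y) = 1 - ⟪x, y⟫` on `ext(C) × ext(C°)`. -/
def slackOperator {n : ℕ} (C : Set (EuclideanSpace ℝ (Fin n)))
    (x : C.extremePoints ℝ) (y : (polar C).extremePoints ℝ) : ℝ :=
  1 - ⟪(x : EuclideanSpace ℝ (Fin n)), (y : EuclideanSpace ℝ (Fin n))⟫_ℝ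

/-- The slack operator of `C` is `K`-factorizable: there are maps `A : ext(C) → K` and
`B : ext(C°) → K*` (the dual cone) with `S_C(x, y) = ⟪A x, B y⟫`. -/
def IsFactorizable {n m : ℕ} (C : Set (EuclideanSpace ℝ (Fin n)))
    (K : Set (EuclideanSpace ℝ (Fin m))) : Prop :=
  ∃ (A : C.extremePoints ℝ → EuclideanSpace ℝ (Fin m))
    (B : (polar C).extremePoints ℝ → EuclideanSpace ℝ (Fin m)),
    (∀ x, A x ∈ K) ∧ (∀ y, B y ∈ ProperCone.innerDual K) ∧
      ∀ x y, slackOperator C x y = ⟪A x, B y⟫_ℝ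

/-- The nonnegative orthant `ℝ₊ᵏ`. -/
def nonnegOrthant (k : ℕ) : Set (EuclideanSpace ℝ (Fin k)) :=
  {v | ∀ i, 0 ≤ v i}

/-- The nonnegative rank `rank₊(C)`: the smallest `k` such that the slack operator of `C` is
`ℝ₊ᵏ`-factorizable, and `⊤` if there is no such `k`. -/
def nonnegRank {n : ℕ} (C : Set (EuclideanSpace ℝ (Fin n))) : ℕ∞ :=
  ⨅ (k : ℕ) (_ : IsFactorizable C (nonnegOrthant k)), (k : ℕ∞)

end ConeLift

end

/-!
Fix a factorization `1 - ⟪x, y⟫ = ⟪A x, B y⟫` of the slack operator through `ℝ₊ᵏ`, and send a face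
`F` of `C` to the union `faceSupport A F ⊆ Fin k` of the supports of the vectors `A x`, for `x` an
extreme point of `C` in `F`. This map reflects inclusions (`subset_of_faceSupport_subset`). Indeed,
if `x` is an extreme point of `C` outside the face `G`, some extreme point `y` of the polar has
`⟪g, y⟫ = 1` on `G` but `⟪x, y⟫ ≠ 1` (`exists_extremePoint_polar_separating`).
All entries being nonnegative, the support of `B y` is then disjoint from `faceSupport A G`, while it
meets the support of `A x`. So an extreme point of `F` outside `G` produces an element of
`faceSupport A F` missing from `faceSupport A G`. As a face is the closed convex hull of its extreme
points, this gives the claim.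

Hence the faces of `C`, ordered by inclusion, embed in the subsets of a `k`-element set: there are
at most `2 ^ k` of them, and Sperner's theorem bounds their antichains.

The separating `y` comes from the Krein–Milman theorem, applied to the face
`{y ∈ C° | ∀ g ∈ G, ⟪g, y⟫ = 1}` of the polar, which is compact because `0 ∈ interior C`.
-/

namespace ConeLift

variable {n : ℕ} {C : Set (EuclideanSpace ℝ (Fin n))}

/-! ### The polar -/

theorem isClosed_polar (C : Set (EuclideanSpace ℝ (Fin n))) : IsClosed (polar C) := by
  have h : polar C = ⋂ x ∈ C, {y | ⟪x, y⟫_ℝ ≤ 1} := by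
    ext y
    simp [polar]
  rw [h]
  exact isClosed_biInter fun x _ => isClosed_le (by fun_prop) continuous_const

theorem isCompact_polar (h0 : 0 ∈ interior C) : IsCompact (polar C) := by
  obtain ⟨r, hr, hball⟩ := Metric.isOpen_iff.1 isOpen_interior 0 h0
  refine Metric.isCompact_of_isClosed_isBounded (isClosed_polar C) ?_
  refine (Metric.isBounded_closedBall (x := 0) (r := 2 / r)).subset fun y hy => ?_
  rw [mem_closedBall_zero_iff]
  rcases eq_or_ne y 0 with rfl | hy0
  · rw [norm_zero]
    positivity
  have hpos : 0 < ‖y‖ := norm_pos_iff.2 hy0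
  -- Test `y` against its positive multiple of norm `r / 2`.
  have hmem : (r / 2 / ‖y‖) • y ∈ C := by
    refine interior_subset (hball ?_)
    rw [mem_ball_zero_iff, norm_smul, Real.norm_of_nonneg (by positivity),
      div_mul_cancel₀ _ hpos.ne']
    linarith
  have h := hy _ hmem
  rw [real_inner_smul_left, real_inner_self_eq_norm_sq] at h
  have h' : r / 2 / ‖y‖ * ‖y‖ ^ 2 = ‖y‖ * r / 2 := by field_simp
  rw [le_div_iff₀ hr]
  linarith

/-- A face of `C` other than `C` itself is cut out by an equation `⟪x, y⟫ = 1` with `y` in the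
polar. The empty face is given by `y = 0`. -/
theorem exists_mem_polar_of_mem_faces {F : Set (EuclideanSpace ℝ (Fin n))} (h0 : 0 ∈ interior C)
    (hF : F ∈ faces C) (hFC : F ≠ C) : ∃ y ∈ polar C, F = {x ∈ C | ⟪x, y⟫_ℝ = 1} := by
  rcases F.eq_empty_or_nonempty with rfl | hne
  · exact ⟨0, fun x _ => by simp, by simp⟩
  obtain ⟨l, hl⟩ := hF hne
  obtain ⟨z, hz⟩ := hne
  have hz' : z ∈ C ∧ ∀ y ∈ C, l y ≤ l z := by rwa [hl] at hz
  have hF' : F = {x ∈ C | l x = l z} := by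
    rw [hl]
    ext x
    exact ⟨fun h => ⟨h.1, le_antisymm (hz'.2 _ h.1) (h.2 _ hz'.1)⟩,
      fun h => ⟨h.1, fun y hy => (hz'.2 y hy).trans h.2.ge⟩⟩
  have hlz : 0 < l z := by
    refine lt_of_le_of_ne (by simpa using hz'.2 0 (interior_subset h0)) fun hzero => hFC ?_
    -- If the maximum is `0`, it is attained at the interior point `0`, so `l` vanishes.
    have hl0 : l = 0 := by
      have hmax : IsLocalMax l 0 := by
        filter_upwards [mem_interior_iff_mem_nhds.1 h0] with y hy
        simpa [hzero] using hz'.2 y hy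
      exact hmax.hasFDerivAt_eq_zero l.hasFDerivAt
    rw [hF', hl0]
    simp
  have hrepr : ∀ x, ⟪x, (l z)⁻¹ • (InnerProductSpace.toDual ℝ _).symm l⟫_ℝ = (l z)⁻¹ * l x := by
    intro x
    rw [real_inner_smul_right, real_inner_comm, InnerProductSpace.toDual_symm_apply]
  refine ⟨(l z)⁻¹ • (InnerProductSpace.toDual ℝ _).symm l, fun x hx => ?_, ?_⟩
  · rw [hrepr, inv_mul_le_one₀ hlz]
    exact hz'.2 x hx
  · simp_rw [hrepr, inv_mul_eq_one₀ hlz.ne', eq_comm (a := l z)]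
    exact hF'

theorem exists_extremePoint_polar_separating {F : Set (EuclideanSpace ℝ (Fin n))}
    {x : EuclideanSpace ℝ (Fin n)} (h0 : 0 ∈ interior C) (hF : F ∈ faces C) (hx : x ∈ C)
    (hxF : x ∉ F) :
    ∃ y ∈ (polar C).extremePoints ℝ, (∀ g ∈ F, ⟪g, y⟫_ℝ = 1) ∧ ⟪x, y⟫_ℝ ≠ 1 := by
  obtain ⟨y₀, hy₀, hFy₀⟩ := exists_mem_polar_of_mem_faces h0 hF fun h => hxF (h ▸ hx)
  have hFC : F ⊆ C := hFy₀ ▸ sep_subset _ _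
  set T : Set (EuclideanSpace ℝ (Fin n)) := polar C ∩ {y | ∀ g ∈ F, ⟪g, y⟫_ℝ = 1} with hT
  have hT' : T = polar C ∩ ⋂ g ∈ F, {y | ⟪g, y⟫_ℝ = 1} := by
    ext y
    simp [hT]
  have hcompact : IsCompact T := by
    rw [hT']
    exact (isCompact_polar h0).inter_right
      (isClosed_biInter fun g _ => isClosed_eq (by fun_prop) continuous_const)
  have hconv : Convex ℝ T := by
    rintro a ⟨ha, ha'⟩ b ⟨hb, hb'⟩ s t hs ht hst
    refine ⟨fun g hg => ?_, fun g hg => ?_⟩ <;>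
      rw [inner_add_right, real_inner_smul_right, real_inner_smul_right]
    · nlinarith [ha g hg, hb g hg]
    · rw [ha' g hg, hb' g hg, mul_one, mul_one, hst]
  have hext : IsExtreme ℝ (polar C) T := by
    refine ⟨inter_subset_left, ?_⟩
    rintro a ha b hb _ ⟨-, hc⟩ ⟨s, t, hs, ht, hst, rfl⟩
    refine ⟨ha, fun g hg => le_antisymm (ha g (hFC hg)) ?_⟩
    have h := hc g hg
    rw [inner_add_right, real_inner_smul_right, real_inner_smul_right] at h
    have h1 : t * ⟪g, b⟫_ℝ ≤ t * 1 := mul_le_mul_of_nonneg_left (hb g (hFC hg)) ht.le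
    refine le_of_mul_le_mul_left ?_ hs
    linarith
  have hy₀T : y₀ ∈ T := ⟨hy₀, fun g hg => by
    rw [hFy₀] at hg
    exact hg.2⟩
  by_contra! hcon
  have hsub : T.extremePoints ℝ ⊆ {y | ⟪x, y⟫_ℝ = 1} := fun y hy =>
    hcon y (hext.extremePoints_subset_extremePoints hy) (extremePoints_subset hy).2
  have hclosed : IsClosed {y : EuclideanSpace ℝ (Fin n) | ⟪x, y⟫_ℝ = 1} :=
    isClosed_eq (by fun_prop) continuous_const
  have hconvex : Convex ℝ {y : EuclideanSpace ℝ (Fin n) | ⟪x, y⟫_ℝ = 1} :=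
    convex_hyperplane (innerₗ (EuclideanSpace ℝ (Fin n)) x).isLinear 1
  have hmem : y₀ ∈ closure (convexHull ℝ (T.extremePoints ℝ)) := by
    rwa [closure_convexHull_extremePoints hcompact hconv]
  have h1 : ⟪x, y₀⟫_ℝ = 1 := closure_minimal (convexHull_min hsub hconvex) hclosed hmem
  exact hxF (hFy₀ ▸ ⟨hx, h1⟩)

/-! ### Faces of compact convex sets -/

theorem subset_of_extremePoints_inter_subset {F G : Set (EuclideanSpace ℝ (Fin n))}
    (hcomp : IsCompact C) (hconv : Convex ℝ C) (hF : F ∈ faces C) (hG : G ∈ faces C)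
    (h : C.extremePoints ℝ ∩ F ⊆ G) : F ⊆ G := by
  have hF' : IsExposed ℝ C F := hF
  have hG' : IsExposed ℝ C G := hG
  rw [← closure_convexHull_extremePoints (hF'.isCompact hcomp) (hF'.convex hconv)]
  refine closure_minimal (convexHull_min (fun x hx => h ?_) (hG'.convex hconv))
    (hG'.isCompact hcomp).isClosed
  exact ⟨hF'.isExtreme.extremePoints_subset_extremePoints hx, extremePoints_subset hx⟩

theorem IsPolytope.isCompact (hC : IsPolytope C) : IsCompact C := by
  obtain ⟨s, hs, rfl⟩ := hC
  exact hs.isCompact_convexHull ℝ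

theorem IsPolytope.convex (hC : IsPolytope C) : Convex ℝ C := by
  obtain ⟨s, hs, rfl⟩ := hC
  exact convex_convexHull ℝ s

theorem IsPolytope.finite_extremePoints (hC : IsPolytope C) : (C.extremePoints ℝ).Finite := by
  obtain ⟨s, hs, rfl⟩ := hC
  exact hs.subset extremePoints_convexHull_subset

theorem IsPolytope.finite_faces (hC : IsPolytope C) : (faces C).Finite := by
  refine Set.Finite.of_finite_image (f := fun F => C.extremePoints ℝ ∩ F)
    (hC.finite_extremePoints.finite_subsets.subset ?_) ?_
  · rintro _ ⟨F, -, rfl⟩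
    exact inter_subset_left
  · intro F hF G hG (h : C.extremePoints ℝ ∩ F = C.extremePoints ℝ ∩ G)
    exact Subset.antisymm
      (subset_of_extremePoints_inter_subset hC.isCompact hC.convex hF hG
        (h ▸ inter_subset_right))
      (subset_of_extremePoints_inter_subset hC.isCompact hC.convex hG hF
        (h.symm ▸ inter_subset_right))

/-! ### The face lattice inside a Boolean lattice -/

open Classical in
/-- The union of the supports of the vectors `A x`, for `x` an extreme point of `C` in `F`. -/
noncomputable def faceSupport {k : ℕ} (A : C.extremePoints ℝ → EuclideanSpace ℝ (Fin k))
    (F : Set (EuclideanSpace ℝ (Fin n))) : Finset (Fin k) :=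
  {i | ∃ x : C.extremePoints ℝ, (x : EuclideanSpace ℝ (Fin n)) ∈ F ∧ A x i ≠ 0}

theorem mem_faceSupport {k : ℕ} {A : C.extremePoints ℝ → EuclideanSpace ℝ (Fin k)}
    {F : Set (EuclideanSpace ℝ (Fin n))} {i : Fin k} :
    i ∈ faceSupport A F ↔
      ∃ x : C.extremePoints ℝ, (x : EuclideanSpace ℝ (Fin n)) ∈ F ∧ A x i ≠ 0 := by
  simp [faceSupport]

/-- The dual cone of the nonnegative orthant is contained in the orthant. -/
theorem nonneg_of_mem_innerDual_nonnegOrthant {k : ℕ} {v : EuclideanSpace ℝ (Fin k)}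
    (hv : v ∈ ProperCone.innerDual (nonnegOrthant k)) (i : Fin k) : 0 ≤ v i := by
  have hmem : EuclideanSpace.single i (1 : ℝ) ∈ nonnegOrthant k := fun j => by
    rw [PiLp.single_apply]
    split_ifs <;> norm_num
  simpa [EuclideanSpace.inner_single_left] using ProperCone.mem_innerDual.1 hv hmem

theorem subset_of_faceSupport_subset {k : ℕ} (hcomp : IsCompact C) (hconv : Convex ℝ C)
    (h0 : 0 ∈ interior C) {A : C.extremePoints ℝ → EuclideanSpace ℝ (Fin k)}
    {B : (polar C).extremePoints ℝ → EuclideanSpace ℝ (Fin k)}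
    (hA : ∀ x, A x ∈ nonnegOrthant k)
    (hB : ∀ y, B y ∈ ProperCone.innerDual (nonnegOrthant k))
    (hAB : ∀ x y, slackOperator C x y = ⟪A x, B y⟫_ℝ)
    {F G : Set (EuclideanSpace ℝ (Fin n))} (hF : F ∈ faces C) (hG : G ∈ faces C)
    (h : faceSupport A F ⊆ faceSupport A G) : F ⊆ G := by
  refine subset_of_extremePoints_inter_subset hcomp hconv hF hG ?_
  rintro x ⟨hx, hxF⟩
  by_contra hxG
  obtain ⟨y, hy, hyG, hxy⟩ :=
    exists_extremePoint_polar_separating h0 hG (extremePoints_subset hx) hxG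
  have hslack : ∀ z (hz : z ∈ C.extremePoints ℝ),
      1 - ⟪z, y⟫_ℝ = ∑ i, A ⟨z, hz⟩ i * B ⟨y, hy⟩ i := fun z hz => by
    have h1 := hAB ⟨z, hz⟩ ⟨y, hy⟩
    rw [PiLp.inner_apply (A _)] at h1
    simpa only [slackOperator, RCLike.inner_apply, conj_trivial, mul_comm] using h1
  have hne : ∑ i, A ⟨x, hx⟩ i * B ⟨y, hy⟩ i ≠ 0 := by
    rw [← hslack x hx]
    exact sub_ne_zero.2 hxy.symm
  obtain ⟨i, -, hi⟩ := Finset.exists_ne_zero_of_sum_ne_zero hne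
  obtain ⟨g, hgG, hg⟩ :=
    mem_faceSupport.1 (h (mem_faceSupport.2 ⟨⟨x, hx⟩, hxF, left_ne_zero_of_mul hi⟩))
  have hsum : ∑ j, A g j * B ⟨y, hy⟩ j = 0 := by
    rw [← hslack g g.2, hyG g hgG, sub_self]
  have hzero := (Finset.sum_eq_zero_iff_of_nonneg fun j _ =>
    mul_nonneg (hA g j) (nonneg_of_mem_innerDual_nonnegOrthant (hB ⟨y, hy⟩) j)).1 hsum i
    (Finset.mem_univ i)
  exact mul_ne_zero hg (right_ne_zero_of_mul hi) hzero

/-! ### Bounds on factorizations -/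

theorem IsFactorizable.exists_faceSupport {k : ℕ} (hC : IsPolytope C) (h0 : 0 ∈ interior C)
    (hfac : IsFactorizable C (nonnegOrthant k)) :
    ∃ f : Set (EuclideanSpace ℝ (Fin n)) → Finset (Fin k),
      ∀ F ∈ faces C, ∀ G ∈ faces C, f F ⊆ f G → F ⊆ G := by
  obtain ⟨A, B, hA, hB, hAB⟩ := hfac
  exact ⟨faceSupport A, fun F hF G hG =>
    subset_of_faceSupport_subset hC.isCompact hC.convex h0 hA hB hAB hF hG⟩

theorem IsFactorizable.encard_antichain_le {k : ℕ} (hC : IsPolytope C) (h0 : 0 ∈ interior C)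
    (hfac : IsFactorizable C (nonnegOrthant k)) {S : Set (Set (EuclideanSpace ℝ (Fin n)))}
    (hS : S ⊆ faces C) (hanti : IsAntichain (· ⊆ ·) S) :
    S.encard ≤ (k.choose (k / 2) : ℕ) := by
  classical
  obtain ⟨f, hf⟩ := hfac.exists_faceSupport hC h0
  have hinj : InjOn f S := fun F hF G hG h =>
    (hf F (hS hF) G (hS hG) h.subset).antisymm (hf G (hS hG) F (hS hF) h.superset)
  have hanti' : IsAntichain (· ⊆ ·) ((f '' S).toFinset : Set (Finset (Fin k))) := by
    rw [coe_toFinset]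
    rintro _ ⟨F, hF, rfl⟩ _ ⟨G, hG, rfl⟩ hne hle
    exact hanti hF hG (fun h => hne (h ▸ rfl)) (hf F (hS hF) G (hS hG) hle)
  have h := hanti'.sperner
  rw [Fintype.card_fin] at h
  rw [← hinj.encard_image, ← Set.coe_toFinset (f '' S), Set.encard_coe_eq_coe_finsetCard]
  exact_mod_cast h

theorem IsFactorizable.encard_faces_le {k : ℕ} (hC : IsPolytope C) (h0 : 0 ∈ interior C)
    (hfac : IsFactorizable C (nonnegOrthant k)) : (faces C).encard ≤ (2 ^ k : ℕ) := by
  obtain ⟨f, hf⟩ := hfac.exists_faceSupport hC h0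
  have hinj : InjOn f (faces C) := fun F hF G hG h =>
    (hf F hF G hG h.subset).antisymm (hf G hG F hF h.superset)
  rw [← hinj.encard_image]
  refine (Set.encard_le_encard (subset_univ _)).trans ?_
  simp [Set.encard_univ]

theorem exists_isGreatest_encard_antichain {α : Type*} (r : α → α → Prop) {U : Set α}
    (hU : U.Finite) :
    ∃ p : ℕ, IsGreatest {m : ℕ∞ | ∃ S ⊆ U, IsAntichain r S ∧ S.encard = m} (p : ℕ∞) := by
  obtain ⟨S, ⟨hSU, hS⟩, hmax⟩ := Set.exists_max_image {S | S ⊆ U ∧ IsAntichain r S} Set.encard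
    (hU.finite_subsets.subset fun S h => h.1) ⟨∅, empty_subset _, IsAntichain.empty⟩
  refine ⟨S.ncard, ⟨S, hSU, hS, ((hU.subset hSU).cast_ncard_eq).symm⟩, ?_⟩
  rintro _ ⟨T, hTU, hT, rfl⟩
  rw [(hU.subset hSU).cast_ncard_eq]
  exact hmax T ⟨hTU, hT⟩

end ConeLift

theorem mainTheorem8 (n : ℕ) (C : Set (EuclideanSpace ℝ (Fin n)))
    (hC : ConeLift.IsPolytope C) (h0 : 0 ∈ interior C) :
    (∃ p k : ℕ,
      IsGreatest {m : ℕ∞ | ∃ S ⊆ ConeLift.faces C, IsAntichain (· ⊆ ·) S ∧ S.encard = m} (p : ℕ∞) ∧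
      IsLeast {j : ℕ | p ≤ j.choose (j / 2)} k ∧
      (k : ℕ∞) ≤ ConeLift.nonnegRank C) ∧
    (∃ N : ℕ, (ConeLift.faces C).encard = (N : ℕ∞) ∧
      ((Real.logb 2 (N : ℝ) : ℝ) : EReal) ≤ ((ConeLift.nonnegRank C : ENNReal) : EReal)) := by
  constructor
  · obtain ⟨p, hp⟩ := ConeLift.exists_isGreatest_encard_antichain (· ⊆ ·) hC.finite_faces
    have hne : {j : ℕ | p ≤ j.choose (j / 2)}.Nonempty :=
      ⟨p, by simpa using Nat.choose_le_middle 1 p⟩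
    refine ⟨p, sInf {j : ℕ | p ≤ j.choose (j / 2)}, hp,
      ⟨Nat.sInf_mem hne, fun j hj => Nat.sInf_le hj⟩, ?_⟩
    refine le_iInf₂ fun k hk => Nat.cast_le.2 (Nat.sInf_le ?_)
    obtain ⟨S, hS, hanti, hcard⟩ := hp.1
    exact_mod_cast hcard ▸ hk.encard_antichain_le hC h0 hS hanti
  · refine ⟨(ConeLift.faces C).ncard, hC.finite_faces.cast_ncard_eq.symm, ?_⟩
    set N := (ConeLift.faces C).ncard
    -- The rank is a natural number or `⊤`, so it suffices to bound it below by `⌈log₂ N⌉`.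
    have hceil : ((⌈Real.logb 2 N⌉₊ : ℕ) : ℕ∞) ≤ ConeLift.nonnegRank C := by
      refine le_iInf₂ fun k hk => Nat.cast_le.2 (Nat.ceil_le.2 ?_)
      have hle : N ≤ 2 ^ k := by
        exact_mod_cast hC.finite_faces.cast_ncard_eq ▸ hk.encard_faces_le hC h0
      have hpos : 0 < N :=
        (Set.ncard_pos hC.finite_faces).2 ⟨∅, fun h => absurd h not_nonempty_empty⟩
      rw [Real.logb_le_iff_le_rpow one_lt_two (by exact_mod_cast hpos), Real.rpow_natCast]
      exact_mod_cast hle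
    have h1 : ((⌈Real.logb 2 N⌉₊ : ℕ) : ENNReal) ≤ (ConeLift.nonnegRank C : ENNReal) := by
      exact_mod_cast ENat.toENNReal_le.2 hceil
    calc ((Real.logb 2 (N : ℝ) : ℝ) : EReal) ≤ ((⌈Real.logb 2 N⌉₊ : ℝ) : EReal) :=
          EReal.coe_le_coe_iff.2 (Nat.le_ceil _)
      _ = (((⌈Real.logb 2 N⌉₊ : ℕ) : ENNReal) : EReal) := by
          rw [← ENNReal.ofReal_natCast, EReal.coe_ennreal_ofReal, max_eq_left (Nat.cast_nonneg _)]
      _ ≤ _ := EReal.coe_ennreal_le_coe_ennreal_iff.2 h1
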